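/- Let $(\Omega,\Sigma,\mu)$ be a $\sigma$-finite measure space. Let $\Phi:\mathbb R\to\mathbb R$ be a Young function, i.e. a continuous convex even function with $\Phi(x)=0$ iff $x=0$, $\Phi(x)/x\to\infty$ and $\Phi(x)\to\infty$ as $x\to\infty$. Let $L^\Phi(\Sigma)$ be the Orlicz space of (a.e. classes of) measurable $f:\Omega\to\mathbb C$ with $\int_\Omega\Phi(k|f|)\,d\mu<\infty$ for some $k>0$, normed by $N_\Phi(f)=\inf\{k>0:\int_\Omega\Phi(|f|/k)\,d\mu\le 1\}$. For a bounded operator $T$ on $L^\Phi(\Sigma)$ let $\|T\|_e=\inf\{\|T-S\| : S \text{ a compact operator on } L^\Phi(\Sigma)\}$ be its essential norm. An atom is a set $A\in\Sigma$ with $\mu(A)>0$ such that every $F\in\Sigma$ with $F\subseteq A$ has $\mu(F)=0$ or $\mu(F)=\mu(A)$. Write $\Omega=\bigl(\bigcup_n A_n\bigr)\cup B$ with $(A_n)$ a countable (finite or infinite) family of pairwise disjoint atoms and $B$ disjoint from all $A_n$ and containing no atom, and put $a_n=\mu(A_n)$. Let $u:\Omega\to\mathbb C$ be $\Sigma$-measurable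 and suppose that the multiplication operator $M_u f=uf$ is a bounded operator from $L^\Phi(\Sigma)$ into itself. Let $$\beta=\inf\{\varepsilon>0:\ \{|u|\ge\varepsilon\}\text{ consists, up to a null set, of finitely many (possibly zero) atoms}\}.$$ **Corollary 3.4.** (a) $\|M_u\|_e\le\beta$. (b) Suppose that $\Phi\in\Delta_2$, i.e. there are $k>0$ and $x_0\ge 0$ with $\Phi(2x)\le k\,\Phi(x)$ for all $x\ge x_0$, and that either $a_n\to 0$ (which holds vacuously if there are only finitely many atoms) or $(a_n)$ has no subsequence converging to a real number. Then $\|M_u\|_e=\beta$. -/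

import Mathlib

open MeasureTheory Filter Topology
open scoped ENNReal

/-- A (finite-valued) Young function: a continuous convex even function on `ℝ` that vanishes exactly
at `0`, with `Φ x / x → ∞` and `Φ x → ∞` as `x → ∞`. -/
structure YoungFunction where
  toFun : ℝ → ℝ
  continuous_toFun : Continuous toFun
  convex_toFun : ConvexOn ℝ Set.univ toFun
  eq_zero_iff : ∀ x, toFun x = 0 ↔ x = 0
  even : ∀ x, toFun (-x) = toFun x
  tendsto_div : Tendsto (fun x => toFun x / x) atTop atTop
  tendsto_atTop : Tendsto toFun atTop atTop

namespace YoungFunction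

instance : CoeFun YoungFunction (fun _ => ℝ → ℝ) := ⟨toFun⟩

variable (Φ : YoungFunction)

/-- The `Δ₂` condition: `Φ (2x) ≤ k Φ x` for all `x ≥ x₀`, for some `k > 0` and `x₀ ≥ 0`. -/
def DeltaTwo : Prop :=
  ∃ k : ℝ, 0 < k ∧ ∃ x₀ : ℝ, 0 ≤ x₀ ∧ ∀ x, x₀ ≤ x → Φ (2 * x) ≤ k * Φ x

theorem map_zero : Φ 0 = 0 := (Φ.eq_zero_iff 0).2 rfl

theorem comb {a b s t : ℝ} (ha : 0 ≤ a) (hb : 0 ≤ b) (h : a + b = 1) :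
    Φ (a * s + b * t) ≤ a * Φ s + b * Φ t := by
  simpa using Φ.convex_toFun.2 (Set.mem_univ s) (Set.mem_univ t) ha hb h

theorem nonneg (x : ℝ) : 0 ≤ Φ x := by
  have h := Φ.comb (a := 1 / 2) (b := 1 / 2) (s := x) (t := -x) (by norm_num) (by norm_num)
    (by norm_num)
  have e : (1 / 2 : ℝ) * x + 1 / 2 * (-x) = 0 := by ring
  rw [e, Φ.map_zero, Φ.even] at h
  linarith

theorem map_mul_le {a : ℝ} (ha : 0 ≤ a) (ha1 : a ≤ 1) (x : ℝ) : Φ (a * x) ≤ a * Φ x := by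
  have h := Φ.comb (a := a) (b := 1 - a) (s := x) (t := 0) ha (by linarith) (by ring)
  simpa [Φ.map_zero] using h

theorem mono {x y : ℝ} (hx : 0 ≤ x) (hxy : x ≤ y) : Φ x ≤ Φ y := by
  rcases hx.eq_or_lt with rfl | hx
  · rw [Φ.map_zero]; exact Φ.nonneg y
  · have hy : 0 < y := hx.trans_le hxy
    have h := Φ.map_mul_le (a := x / y) (by positivity) ((div_le_one hy).2 hxy) y
    rw [div_mul_cancel₀ _ hy.ne'] at h
    have h1 : x / y ≤ 1 := (div_le_one hy).2 hxy
    nlinarith [Φ.nonneg y]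

end YoungFunction

section Orlicz

variable {Ω : Type*} [MeasurableSpace Ω]

/-- The modular `∫ Φ(c |f|) dμ`, with values in `[0, ∞]`. -/
noncomputable def orliczModular (Φ : YoungFunction) (μ : Measure Ω) (c : ℝ) (f : Ω →ₘ[μ] ℂ) : ℝ≥0∞ :=
  ∫⁻ x, ENNReal.ofReal (Φ (c * ‖f x‖)) ∂μ

variable (Φ : YoungFunction) {μ : Measure Ω}

theorem orliczModular_mono {c d : ℝ} (hc : 0 ≤ c) (hcd : c ≤ d) (f : Ω →ₘ[μ] ℂ) :
    orliczModular Φ μ c f ≤ orliczModular Φ μ d f := by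
  refine lintegral_mono fun x => ENNReal.ofReal_le_ofReal (Φ.mono (by positivity) ?_)
  gcongr

theorem orliczModular_mul_le {a : ℝ} (ha : 0 ≤ a) (ha1 : a ≤ 1) (c : ℝ) (f : Ω →ₘ[μ] ℂ) :
    orliczModular Φ μ (a * c) f ≤ ENNReal.ofReal a * orliczModular Φ μ c f := by
  unfold orliczModular
  rw [← lintegral_const_mul' _ _ ENNReal.ofReal_ne_top]
  refine lintegral_mono fun x => ?_
  rw [← ENNReal.ofReal_mul ha, mul_assoc]
  exact ENNReal.ofReal_le_ofReal (Φ.map_mul_le ha ha1 _)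

theorem orliczModular_smul (c : ℝ) (z : ℂ) (f : Ω →ₘ[μ] ℂ) :
    orliczModular Φ μ c (z • f) = orliczModular Φ μ (c * ‖z‖) f := by
  refine lintegral_congr_ae ?_
  filter_upwards [AEEqFun.coeFn_smul z f] with x hx
  simp [hx, mul_assoc]

theorem orliczModular_zero (c : ℝ) : orliczModular Φ μ c (0 : Ω →ₘ[μ] ℂ) = 0 := by
  unfold orliczModular
  rw [lintegral_congr_ae (g := fun _ => 0), lintegral_zero]
  filter_upwards [AEEqFun.coeFn_zero (α := Ω) (β := ℂ) (μ := μ)] with x hx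
  simp [hx, Φ.map_zero]

theorem aemeasurable_orlicz (c : ℝ) (f : Ω →ₘ[μ] ℂ) :
    AEMeasurable (fun x => ENNReal.ofReal (Φ (c * ‖f x‖))) μ := by
  have h1 : AEMeasurable (fun x => ‖f x‖) μ := f.aestronglyMeasurable.norm.aemeasurable
  exact (Φ.continuous_toFun.measurable.comp_aemeasurable (h1.const_mul c)).ennreal_ofReal

theorem orliczModular_add_le {k l : ℝ} (hk : 0 < k) (hl : 0 < l) (f g : Ω →ₘ[μ] ℂ) :
    orliczModular Φ μ (k + l)⁻¹ (f + g) ≤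
      ENNReal.ofReal (k / (k + l)) * orliczModular Φ μ k⁻¹ f +
        ENNReal.ofReal (l / (k + l)) * orliczModular Φ μ l⁻¹ g := by
  unfold orliczModular
  rw [← lintegral_const_mul' _ _ ENNReal.ofReal_ne_top,
    ← lintegral_const_mul' _ _ ENNReal.ofReal_ne_top,
    ← lintegral_add_left' ((aemeasurable_orlicz Φ _ f).const_mul _)]
  refine lintegral_mono_ae ?_
  filter_upwards [AEEqFun.coeFn_add f g] with x hx
  have hkl : 0 < k + l := by positivity
  rw [← ENNReal.ofReal_mul (by positivity), ← ENNReal.ofReal_mul (by positivity),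
    ← ENNReal.ofReal_add (mul_nonneg (by positivity) (Φ.nonneg _))
      (mul_nonneg (by positivity) (Φ.nonneg _))]
  refine ENNReal.ofReal_le_ofReal (le_trans ?_
    (Φ.comb (by positivity) (by positivity) (by field_simp)))
  refine Φ.mono (by positivity) ?_
  rw [hx]
  calc (k + l)⁻¹ * ‖(⇑f + ⇑g) x‖ ≤ (k + l)⁻¹ * (‖f x‖ + ‖g x‖) := by
        gcongr
        exact norm_add_le _ _
    _ = _ := by field_simp

/-- The Orlicz space `L^Φ(μ)`: classes of a.e. equal measurable functions `f : Ω → ℂ` such that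
`∫ Φ(k |f|) dμ < ∞` for some `k > 0`. -/
noncomputable def OrliczSpace (Φ : YoungFunction) (μ : Measure Ω) : Submodule ℂ (Ω →ₘ[μ] ℂ) where
  carrier := {f | ∃ k : ℝ, 0 < k ∧ orliczModular Φ μ k f < ∞}
  zero_mem' := ⟨1, one_pos, by simp [orliczModular_zero]⟩
  add_mem' := by
    rintro f g ⟨k, hk, hf⟩ ⟨l, hl, hg⟩
    refine ⟨(k⁻¹ + l⁻¹)⁻¹, by positivity, ?_⟩
    refine (orliczModular_add_le Φ (inv_pos.2 hk) (inv_pos.2 hl) f g).trans_lt ?_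
    rw [inv_inv, inv_inv]
    exact ENNReal.add_lt_top.2 ⟨ENNReal.mul_lt_top ENNReal.ofReal_lt_top hf,
      ENNReal.mul_lt_top ENNReal.ofReal_lt_top hg⟩
  smul_mem' := by
    rintro z f ⟨k, hk, hf⟩
    refine ⟨k / (‖z‖ + 1), by positivity, ?_⟩
    rw [orliczModular_smul]
    refine (orliczModular_mono Φ (by positivity) ?_ f).trans_lt hf
    rw [div_mul_eq_mul_div, div_le_iff₀ (by positivity)]
    nlinarith

/-- The (Luxemburg) norm `N_Φ(f) = inf {k > 0 : ∫ Φ(|f| / k) dμ ≤ 1}`. -/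
noncomputable instance (Φ : YoungFunction) (μ : Measure Ω) : Norm (OrliczSpace Φ μ) where
  norm f := sInf {k : ℝ | 0 < k ∧ ∫⁻ x, ENNReal.ofReal (Φ (‖(f : Ω →ₘ[μ] ℂ) x‖ / k)) ∂μ ≤ 1}

namespace OrliczSpace

variable {Φ}

theorem norm_def (f : OrliczSpace Φ μ) :
    ‖f‖ = sInf {k : ℝ | 0 < k ∧ orliczModular Φ μ k⁻¹ f ≤ 1} := by
  simp only [orliczModular, inv_mul_eq_div]
  rfl

theorem norm_le {f : OrliczSpace Φ μ} {k : ℝ} (hk : 0 < k)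
    (h : orliczModular Φ μ k⁻¹ f ≤ 1) : ‖f‖ ≤ k := by
  rw [norm_def]
  exact csInf_le ⟨0, fun r hr => hr.1.le⟩ ⟨hk, h⟩

theorem set_nonempty (f : OrliczSpace Φ μ) :
    {k : ℝ | 0 < k ∧ orliczModular Φ μ k⁻¹ f ≤ 1}.Nonempty := by
  obtain ⟨f, k, hk, hf⟩ := f
  set m := (orliczModular Φ μ k f).toReal with hm
  have hm0 : 0 ≤ m := ENNReal.toReal_nonneg
  refine ⟨((m + 1)⁻¹ * k)⁻¹, by positivity, ?_⟩
  rw [inv_inv]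
  refine (orliczModular_mul_le Φ (by positivity) (inv_le_one_of_one_le₀ (by linarith)) k f).trans ?_
  rw [← ENNReal.ofReal_toReal hf.ne, ← hm, ← ENNReal.ofReal_mul (by positivity),
    ← ENNReal.ofReal_one]
  refine ENNReal.ofReal_le_ofReal ?_
  rw [inv_mul_le_iff₀ (by positivity)]
  linarith

theorem modular_le_one {f : OrliczSpace Φ μ} {k : ℝ} (h : ‖f‖ < k) :
    0 < k ∧ orliczModular Φ μ k⁻¹ f ≤ 1 := by
  rw [norm_def] at h
  obtain ⟨l, ⟨hl, hl'⟩, hlk⟩ := exists_lt_of_csInf_lt (set_nonempty f) h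
  have hk : 0 < k := hl.trans hlk
  exact ⟨hk, (orliczModular_mono Φ (by positivity) (inv_anti₀ hl hlk.le) _).trans hl'⟩

theorem norm_nonneg' (f : OrliczSpace Φ μ) : 0 ≤ ‖f‖ := by
  rw [norm_def]
  exact Real.sInf_nonneg fun r hr => hr.1.le

theorem norm_smul_le' (z : ℂ) (f : OrliczSpace Φ μ) : ‖z • f‖ ≤ ‖z‖ * ‖f‖ := by
  refine le_of_forall_pos_le_add fun ε hε => ?_
  have h1 : ‖f‖ < ‖f‖ + ε / (‖z‖ + 1) := lt_add_of_pos_right _ (by positivity)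
  obtain ⟨hk, h⟩ := modular_le_one h1
  have hf := norm_nonneg' f
  have key : ‖z‖ * (‖f‖ + ε / (‖z‖ + 1)) ≤ ‖z‖ * ‖f‖ + ε := by
    have : ‖z‖ * (ε / (‖z‖ + 1)) ≤ ε := by
      rw [mul_div_assoc', div_le_iff₀ (by positivity)]
      nlinarith [norm_nonneg z]
    linarith [mul_add ‖z‖ ‖f‖ (ε / (‖z‖ + 1))]
  have hpos : 0 < ‖z‖ * ‖f‖ + ε := by positivity
  refine norm_le hpos ?_
  rw [Submodule.coe_smul, orliczModular_smul]
  refine (orliczModular_mono Φ (by positivity) ?_ _).trans h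
  rw [inv_mul_le_iff₀ hpos, ← div_eq_mul_inv, le_div_iff₀ hk]
  exact key

theorem core : NormedSpace.Core ℂ (OrliczSpace Φ μ) where
  norm_nonneg := norm_nonneg'
  norm_smul z f := by
    refine le_antisymm (norm_smul_le' z f) ?_
    rcases eq_or_ne z 0 with rfl | hz
    · simpa using norm_nonneg' _
    · have h := norm_smul_le' z⁻¹ (z • f)
      rw [smul_smul, inv_mul_cancel₀ hz, one_smul, norm_inv,
        le_inv_mul_iff₀ (norm_pos_iff.2 hz)] at h
      exact h
  norm_triangle f g := by
    refine le_of_forall_pos_le_add fun ε hε => ?_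
    obtain ⟨hk, h1⟩ := modular_le_one (f := f) (lt_add_of_pos_right _ (half_pos hε))
    obtain ⟨hl, h2⟩ := modular_le_one (f := g) (lt_add_of_pos_right _ (half_pos hε))
    have e : ‖f‖ + ‖g‖ + ε = (‖f‖ + ε / 2) + (‖g‖ + ε / 2) := by ring
    rw [e]
    refine norm_le (by positivity) ?_
    rw [Submodule.coe_add]
    refine (orliczModular_add_le Φ hk hl _ _).trans ?_
    refine (add_le_add (mul_le_mul_right h1 _) (mul_le_mul_right h2 _)).trans ?_
    rw [mul_one, mul_one, ← ENNReal.ofReal_add (by positivity) (by positivity), ← add_div,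
      div_self (by positivity), ENNReal.ofReal_one]
  norm_eq_zero_iff f := by
    constructor
    · intro h
      have h1 : ∀ k : ℝ, 0 < k → k ≤ 1 → orliczModular Φ μ 1 f ≤ ENNReal.ofReal k := by
        intro k hk hk1
        obtain ⟨-, h2⟩ := modular_le_one (f := f) (k := k) (by rwa [h])
        have h3 := orliczModular_mul_le Φ hk.le hk1 k⁻¹ (f : Ω →ₘ[μ] ℂ)
        rw [mul_inv_cancel₀ hk.ne'] at h3
        refine h3.trans ((mul_le_mul_right h2 _).trans ?_)
        rw [mul_one]
      have h0 : orliczModular Φ μ 1 (f : Ω →ₘ[μ] ℂ) = 0 := by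
        by_contra hne
        have hlt : orliczModular Φ μ 1 (f : Ω →ₘ[μ] ℂ) ≠ ∞ :=
          ((h1 1 one_pos le_rfl).trans_lt ENNReal.ofReal_lt_top).ne
        have hp := ENNReal.toReal_pos hne hlt
        set m := (orliczModular Φ μ 1 (f : Ω →ₘ[μ] ℂ)).toReal
        have h2 := h1 (min 1 (m / 2)) (by positivity) (min_le_left _ _)
        have h3 := ENNReal.toReal_mono ENNReal.ofReal_ne_top h2
        rw [ENNReal.toReal_ofReal (by positivity)] at h3
        have h4 : m ≤ m / 2 := h3.trans (min_le_right _ _)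
        linarith
      unfold orliczModular at h0
      rw [lintegral_eq_zero_iff' (aemeasurable_orlicz Φ _ _)] at h0
      refine Subtype.ext (AEEqFun.ext ?_)
      rw [Submodule.coe_zero]
      filter_upwards [h0, AEEqFun.coeFn_zero (α := Ω) (β := ℂ) (μ := μ)] with x hx hx0
      rw [hx0]
      simp only [one_mul, Pi.zero_apply, ENNReal.ofReal_eq_zero] at hx
      have := (Φ.eq_zero_iff _).1 (le_antisymm hx (Φ.nonneg _))
      simpa using this
    · rintro rfl
      refine le_antisymm (le_of_forall_pos_le_add fun ε hε => ?_) (norm_nonneg' _)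
      rw [zero_add]
      refine norm_le hε ?_
      rw [Submodule.coe_zero, orliczModular_zero]
      exact zero_le_one

noncomputable instance : NormedAddCommGroup (OrliczSpace Φ μ) := NormedAddCommGroup.ofCore core

noncomputable instance : NormedSpace ℂ (OrliczSpace Φ μ) := NormedSpace.ofCore core

end OrliczSpace

/-- An atom of `μ`. -/
def IsMeasureAtom (μ : Measure Ω) (A : Set Ω) : Prop :=
  MeasurableSet A ∧ 0 < μ A ∧ ∀ F, MeasurableSet F → F ⊆ A → μ F = 0 ∨ μ F = μ A

/-- `A` is a countable family of pairwise disjoint atoms whose union has a non-atomic complement. -/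
def IsAtomDecomposition (μ : Measure Ω) {ι : Type*} (A : ι → Set Ω) : Prop :=
  Countable ι ∧ (∀ i, IsMeasureAtom μ (A i)) ∧ Pairwise (fun i j => Disjoint (A i) (A j)) ∧
    ∀ F, F ⊆ (⋃ i, A i)ᶜ → ¬ IsMeasureAtom μ F

/-- Up to a null set, `N` is the union of finitely many (possibly zero) atoms of `μ`. -/
def ConsistsOfFinitelyManyAtoms (μ : Measure Ω) (N : Set Ω) : Prop :=
  ∃ S : Set (Set Ω), S.Finite ∧ (∀ A ∈ S, IsMeasureAtom μ A) ∧ N =ᵐ[μ] ⋃₀ S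

/-- The infimum of all `ε > 0` such that `{|u| ≥ ε}` consists of finitely many atoms. -/
noncomputable def atomicThreshold (μ : Measure Ω) (u : Ω → ℂ) : ℝ :=
  sInf {ε : ℝ | 0 < ε ∧ ConsistsOfFinitelyManyAtoms μ {x | ε ≤ ‖u x‖}}

end Orlicz

/-- The essential norm of a bounded operator: its distance, in operator norm, to the compact
operators. -/
noncomputable def essNorm {X : Type*} [NormedAddCommGroup X] [NormedSpace ℂ X] (T : X →L[ℂ] X) : ℝ :=
  sInf {r : ℝ | ∃ S : X →L[ℂ] X, IsCompactOperator S ∧ r = ‖T - S‖}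

/-- No subsequence of the countable family `a` (that is, no `a ∘ φ` with `φ : ℕ → ι` injective)
converges to a real number. -/
def NoConvergentSubsequence {ι : Type*} (a : ι → ℝ) : Prop :=
  ¬ ∃ φ : ℕ → ι, Function.Injective φ ∧ ∃ l : ℝ, Tendsto (a ∘ φ) atTop (𝓝 l)

/-! Upper bound: let `N = {ε ≤ |u|}` be a finite union of atoms. Measurable functions are a.e.
constant on atoms, so multiplication by the indicator of `N` has finite-dimensional range.
Subtracting this compact part of `M` leaves multiplication by a function bounded by `ε`. Lower
bound: for `0 < ε < β` the set `N` is not a finite union of atoms, so it contains disjoint sets `E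
n` of positive measure. Let `Q n` be multiplication by the indicator of `E n`, and suppose `‖M - S‖
< ε` with `S` compact. Then `Q n ∘ S` is bounded below on the range of `Q n`, uniformly in `n`.
Along a subsequence, the images under `S` of unit vectors from these ranges converge to some `y`,
and `‖Q n y‖`, hence also `‖S (Q n y)‖`, stays away from `0`. But the finite sums of the `Q n y` are
bounded by `‖y‖`, which forces `S (Q n y) → 0`. Projecting the single limit `y` replaces weak
convergence of the unit vectors. -/

/-! ### Compact operators and disjoint projections -/

section Abstract

variable {X : Type*} [NormedAddCommGroup X] [NormedSpace ℂ X]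

/-- If all finite partial sums of a sequence are bounded by one constant, then the sequence has no
subsequence with a nonzero limit. -/
theorem eq_zero_of_tendsto_of_norm_sum_le {f : ℕ → X} {C : ℝ}
    (hC : ∀ s : Finset ℕ, ‖∑ n ∈ s, f n‖ ≤ C) {φ : ℕ → ℕ} (hφ : StrictMono φ) {z : X}
    (hz : Tendsto (f ∘ φ) atTop (𝓝 z)) : z = 0 := by
  by_contra hne
  have hpos : 0 < ‖z‖ := norm_pos_iff.2 hne
  -- Beyond `m` the terms are `‖z‖ / 2`-close to `z`, so a block of `K` of them has a sum of norm at
  -- least `K * ‖z‖ / 2`, which exceeds `C`.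
  obtain ⟨m, hm⟩ := Metric.tendsto_atTop.1 hz (‖z‖ / 2) (by positivity)
  obtain ⟨K, hK⟩ := exists_nat_gt (C / (‖z‖ / 2))
  rw [div_lt_iff₀ (by positivity)] at hK
  have h1 := hC ((Finset.Ico m (m + K)).map ⟨φ, hφ.injective⟩)
  rw [Finset.sum_map] at h1
  have h2 : ‖∑ k ∈ Finset.Ico m (m + K), (f (φ k) - z)‖ ≤ K * (‖z‖ / 2) := by
    refine (norm_sum_le_of_le _ (f := fun k => f (φ k) - z) (n := fun _ => ‖z‖ / 2) ?_).trans ?_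
    · intro k hk
      rw [← dist_eq_norm]
      exact (hm k (Finset.mem_Ico.1 hk).1).le
    · simp
  have h3 : (∑ k ∈ Finset.Ico m (m + K), (f (φ k) - z))
      = (∑ k ∈ Finset.Ico m (m + K), f (φ k)) - (K : ℂ) • z := by
    rw [Finset.sum_sub_distrib]
    simp [← Nat.cast_smul_eq_nsmul ℂ]
  rw [h3] at h2
  have h4 : ‖(K : ℂ) • z‖ = K * ‖z‖ := by simp [norm_smul]
  have h5 := norm_sub_norm_le ((K : ℂ) • z) (∑ k ∈ Finset.Ico m (m + K), f (φ k))
  rw [norm_sub_rev, h4] at h5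
  simp only [Function.Embedding.coeFn_mk] at h1
  linarith

/-- A compact operator sends a sequence with bounded finite partial sums to a null sequence. -/
theorem IsCompactOperator.tendsto_zero_of_norm_sum_le {S : X →L[ℂ] X} (hS : IsCompactOperator S)
    {f : ℕ → X} {C : ℝ} (hC : ∀ s : Finset ℕ, ‖∑ n ∈ s, f n‖ ≤ C) :
    Tendsto (fun n => S (f n)) atTop (𝓝 0) := by
  obtain ⟨K, hK, hsub⟩ := hS.image_closedBall_subset_compact (f := (S : X →ₗ[ℂ] X)) C
  have hmem : ∀ n, S (f n) ∈ K := fun n => hsub ⟨f n, by simpa using hC {n}, rfl⟩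
  have hsum : ∀ s : Finset ℕ, ‖∑ n ∈ s, S (f n)‖ ≤ ‖S‖ * C := fun s => by
    rw [← map_sum]
    exact (S.le_opNorm _).trans (by gcongr; exact hC s)
  refine tendsto_of_subseq_tendsto fun ns hns => ?_
  -- The sequence `ns` may repeat indices; the bound on finite sums only controls distinct ones.
  obtain ⟨ψ, -, hψ⟩ := strictMono_subseq_of_tendsto_atTop hns
  obtain ⟨z, -, θ, hθ, hz⟩ := hK.tendsto_subseq fun n => hmem (ns (ψ n))
  refine ⟨ψ ∘ θ, ?_⟩
  have h0 := eq_zero_of_tendsto_of_norm_sum_le hsum (φ := ns ∘ ψ ∘ θ)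
    (StrictMono.comp (g := ns ∘ ψ) (by assumption) hθ) hz
  rw [h0] at hz
  exact hz

/-- If `T` is bounded below by `ε` on the ranges of infinitely many nonzero projections with
contractive finite sums, then `T` has distance at least `ε` to the compact operators. -/
theorem le_norm_sub_of_isCompactOperator {T S : X →L[ℂ] X} (hS : IsCompactOperator S)
    {Q : ℕ → X →L[ℂ] X} (hsum : ∀ (s : Finset ℕ) (y : X), ‖∑ n ∈ s, Q n y‖ ≤ ‖y‖)
    (hidem : ∀ n y, Q n (Q n y) = Q n y) (hne : ∀ n, ∃ y, Q n y ≠ 0) {ε : ℝ}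
    (hlow : ∀ n y, ε * ‖Q n y‖ ≤ ‖Q n (T (Q n y))‖) : ε ≤ ‖T - S‖ := by
  by_contra! hlt
  set c := ε - ‖T - S‖ with hc
  have hc0 : 0 < c := sub_pos.2 hlt
  have hQ : ∀ n y, ‖Q n y‖ ≤ ‖y‖ := fun n y => by simpa using hsum {n} y
  have hbelow : ∀ n y, c * ‖Q n y‖ ≤ ‖Q n (S (Q n y))‖ := by
    intro n y
    have h1 : ‖Q n ((T - S) (Q n y))‖ ≤ ‖T - S‖ * ‖Q n y‖ :=
      (hQ _ _).trans ((T - S).le_opNorm _)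
    have h2 : Q n (T (Q n y)) = Q n ((T - S) (Q n y)) + Q n (S (Q n y)) := by
      rw [← map_add]; simp
    have h3 := norm_add_le (Q n ((T - S) (Q n y))) (Q n (S (Q n y)))
    rw [← h2] at h3
    rw [hc, sub_mul]
    linarith [hlow n y]
  have hunit : ∀ n, ∃ e, Q n e = e ∧ ‖e‖ = 1 := by
    intro n
    obtain ⟨y, hy⟩ := hne n
    refine ⟨((‖Q n y‖⁻¹ : ℝ) : ℂ) • Q n y, by rw [map_smul, hidem], ?_⟩
    rw [norm_smul, Complex.norm_real, norm_inv, norm_norm,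
      inv_mul_cancel₀ (norm_ne_zero_iff.2 hy)]
  choose e he he1 using hunit
  obtain ⟨K, hK, hsub⟩ := hS.image_closedBall_subset_compact (f := (S : X →ₗ[ℂ] X)) 1
  obtain ⟨y, -, φ, hφ, hy⟩ :=
    hK.tendsto_subseq (x := fun n => S (e n)) fun n => hsub ⟨e n, by simp [he1], rfl⟩
  -- The finite sums of `Q n y` are bounded by `‖y‖`, a bound that may fail for the `e n`
  -- themselves.
  have hproj : Tendsto (fun k => S (Q (φ k) y)) atTop (𝓝 0) := by
    refine (hS.tendsto_zero_of_norm_sum_le (f := fun n => Q n y) (C := ‖y‖)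
      fun s => hsum s y).comp hφ.tendsto_atTop
  have h1 : ∀ᶠ k in atTop, dist (S (e (φ k))) y < c / 2 :=
    (Metric.tendsto_nhds.1 hy) _ (by positivity)
  -- The factor `c / 2` is the lower bound for `‖Q n y‖`; the other `c` comes from applying `hbelow`
  -- to `y`.
  have h2 : ∀ᶠ k in atTop, dist (S (Q (φ k) y)) 0 < c * (c / 2) :=
    (Metric.tendsto_nhds.1 hproj) _ (by positivity)
  obtain ⟨k, hk1, hk2⟩ := (h1.and h2).exists
  rw [dist_eq_norm] at hk1
  rw [dist_zero_right] at hk2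
  set n := φ k
  have h3 : c ≤ ‖Q n (S (e n))‖ := by simpa [he, he1] using hbelow n (e n)
  have h4 : ‖Q n (S (e n)) - Q n y‖ < c / 2 := by
    rw [← map_sub]; exact (hQ _ _).trans_lt hk1
  have h5 : c / 2 ≤ ‖Q n y‖ := by
    linarith [norm_le_norm_add_norm_sub' (Q n (S (e n))) (Q n y)]
  have h6 : c * ‖Q n y‖ ≤ ‖S (Q n y)‖ := (hbelow n y).trans (hQ _ _)
  nlinarith

/-- A bounded operator whose range lies in a finite-dimensional subspace is compact. -/
theorem isCompactOperator_of_mem_finiteDimensional (S : X →L[ℂ] X) (V : Submodule ℂ X)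
    [FiniteDimensional ℂ V] (h : ∀ x, S x ∈ V) : IsCompactOperator S := by
  have := FiniteDimensional.proper ℂ V
  have h1 : IsCompactOperator V.subtypeL := isCompactOperator_of_locallyCompactSpace_rng V.subtypeL
  exact h1.comp_clm (S.codRestrict V h)

theorem essNorm_le (T : X →L[ℂ] X) {S : X →L[ℂ] X} (hS : IsCompactOperator S) :
    essNorm T ≤ ‖T - S‖ :=
  csInf_le ⟨0, by rintro _ ⟨_, -, rfl⟩; exact norm_nonneg _⟩ ⟨S, hS, rfl⟩

theorem le_essNorm {T : X →L[ℂ] X} {r : ℝ}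
    (h : ∀ S : X →L[ℂ] X, IsCompactOperator S → r ≤ ‖T - S‖) : r ≤ essNorm T := by
  refine le_csInf ⟨_, 0, isCompactOperator_zero, rfl⟩ ?_
  rintro _ ⟨S, hS, rfl⟩
  exact h S hS

end Abstract

/-! ### Atoms and finite unions of atoms -/

section Atoms

variable {Ω : Type*} [MeasurableSpace Ω] {μ : Measure Ω}

theorem ConsistsOfFinitelyManyAtoms.union {N P : Set Ω} (hN : ConsistsOfFinitelyManyAtoms μ N)
    (hP : ConsistsOfFinitelyManyAtoms μ P) : ConsistsOfFinitelyManyAtoms μ (N ∪ P) := by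
  obtain ⟨S, hS, hSa, hNS⟩ := hN
  obtain ⟨R, hR, hRa, hPR⟩ := hP
  refine ⟨S ∪ R, hS.union hR, ?_, ?_⟩
  · rintro A (hA | hA)
    exacts [hSa A hA, hRa A hA]
  · rw [Set.sUnion_union]
    exact hNS.union hPR

theorem consistsOfFinitelyManyAtoms_of_null {N : Set Ω} (h : μ N = 0) :
    ConsistsOfFinitelyManyAtoms μ N :=
  ⟨∅, Set.finite_empty, by simp, by simpa using ae_eq_empty.2 h⟩

/-- A set that is not a finite union of atoms can be split into a set of positive measure and one
that is not a finite union of atoms either. -/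
theorem exists_split_of_not_finitelyManyAtoms {N : Set Ω} (hN : MeasurableSet N)
    (h : ¬ ConsistsOfFinitelyManyAtoms μ N) :
    ∃ E, MeasurableSet E ∧ E ⊆ N ∧ 0 < μ E ∧ ¬ ConsistsOfFinitelyManyAtoms μ (N \ E) := by
  have hpos : 0 < μ N := by
    rw [pos_iff_ne_zero]
    exact fun h0 => h (consistsOfFinitelyManyAtoms_of_null h0)
  have hna : ¬ IsMeasureAtom μ N := fun ha =>
    h ⟨{N}, Set.finite_singleton N, by simpa using ha,
      by rw [Set.sUnion_singleton]; exact EventuallyEq.rfl⟩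
  obtain ⟨F, hF, hFN, hF0, hF1⟩ :
      ∃ F, MeasurableSet F ∧ F ⊆ N ∧ μ F ≠ 0 ∧ μ F ≠ μ N := by
    by_contra! hcon
    exact hna ⟨hN, hpos, fun F hF hFN => or_iff_not_imp_left.2 (hcon F hF hFN)⟩
  -- Strictness makes `μ F` finite, so the subtraction below is valid even if `μ N = ∞`.
  have hlt : μ F < μ N := lt_of_le_of_ne (measure_mono hFN) hF1
  have hdiff : 0 < μ (N \ F) := by
    rw [measure_sdiff hFN hF.nullMeasurableSet hlt.ne_top]
    exact tsub_pos_of_lt hlt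
  by_cases hg : ConsistsOfFinitelyManyAtoms μ (N \ F)
  · refine ⟨N \ F, hN.diff hF, Set.sdiff_subset, hdiff, ?_⟩
    rw [Set.sdiff_sdiff_cancel_left hFN]
    intro hg'
    apply h
    rw [← Set.sdiff_union_of_subset hFN]
    exact hg.union hg'
  · exact ⟨F, hF, hFN, pos_iff_ne_zero.2 hF0, hg⟩

/-- Iterate the splitting: each remainder `R n` is again not a finite union of atoms, and each
removed piece misses all later remainders. -/
theorem exists_disjoint_seq_of_not_finitelyManyAtoms {N : Set Ω} (hN : MeasurableSet N)
    (h : ¬ ConsistsOfFinitelyManyAtoms μ N) :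
    ∃ E : ℕ → Set Ω, (∀ n, MeasurableSet (E n)) ∧ (∀ n, E n ⊆ N) ∧ (∀ n, 0 < μ (E n)) ∧
      Pairwise (fun i j => Disjoint (E i) (E j)) := by
  choose! f hfm hfs hfp hfn using
    fun (P : Set Ω) (hP : MeasurableSet P ∧ ¬ ConsistsOfFinitelyManyAtoms μ P) =>
      exists_split_of_not_finitelyManyAtoms hP.1 hP.2
  let R : ℕ → Set Ω := fun n => (fun P => P \ f P)^[n] N
  have hRs : ∀ n, R (n + 1) = R n \ f (R n) := fun n => Function.iterate_succ_apply' _ _ _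
  have hR : ∀ n, MeasurableSet (R n) ∧ ¬ ConsistsOfFinitelyManyAtoms μ (R n) := by
    intro n
    induction n with
    | zero => exact ⟨hN, h⟩
    | succ n ih =>
      rw [hRs]
      exact ⟨ih.1.diff (hfm _ ih), hfn _ ih⟩
  have hanti : Antitone R := antitone_nat_of_succ_le fun n => by
    rw [hRs]; exact Set.sdiff_subset
  refine ⟨fun n => f (R n), fun n => hfm _ (hR n),
    fun n => (hfs _ (hR n)).trans (hanti n.zero_le), fun n => hfp _ (hR n), ?_⟩
  refine (pairwise_disjoint_on _).2 fun m n hmn => ?_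
  refine Set.disjoint_of_subset_right
    ((hfs _ (hR n)).trans (hanti (Nat.succ_le_of_lt hmn))) ?_
  rw [Nat.succ_eq_add_one, hRs]
  exact Set.disjoint_sdiff_right

/-- Measurable functions are almost everywhere constant on an atom of a `σ`-finite measure. -/
theorem IsMeasureAtom.exists_ae_eq_const [SigmaFinite μ] {A : Set Ω} (hA : IsMeasureAtom μ A)
    {f : Ω → ℂ} (hf : Measurable f) : ∃ c : ℂ, ∀ᵐ x ∂μ, x ∈ A → f x = c := by
  obtain ⟨hAm, hpos, hat⟩ := hA
  -- By `σ`-finiteness `A` has a subset of positive finite measure, which must carry all of `μ A`.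
  have hfin : μ A ≠ ∞ := by
    obtain ⟨t, htm, hts, ht0, ht1⟩ := Measure.exists_subset_measure_lt_top hAm hpos
    rcases hat t htm hts with h | h
    · exact absurd h ht0.ne'
    · exact h ▸ ht1.ne
  -- Every measurable preimage is null or conull in `A`, and countably many measurable sets separate
  -- the points of `ℂ`.
  obtain ⟨c, hc⟩ := exists_eventuallyEq_const_of_forall_separating
    (l := ae (μ.restrict A)) (f := f) MeasurableSet fun U hU => by
      have hm : MeasurableSet (A ∩ f ⁻¹' U) := hAm.inter (hf hU)
      rcases hat _ hm Set.inter_subset_left with h | h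
      · right
        rw [ae_restrict_iff' hAm, ae_iff]
        refine measure_mono_null (fun x hx => ?_) h
        simpa using hx
      · left
        have h0 : μ (A \ (A ∩ f ⁻¹' U)) = 0 := by
          rw [measure_sdiff Set.inter_subset_left hm.nullMeasurableSet (h ▸ hfin), h, tsub_self]
        rw [ae_restrict_iff' hAm, ae_iff]
        refine measure_mono_null (fun x hx => ?_) h0
        simpa using hx
  exact ⟨c, (ae_restrict_iff' hAm).1 hc⟩

end Atoms

/-! ### Multiplication by indicator functions -/

namespace OrliczSpace

variable {Ω : Type*} [MeasurableSpace Ω] {μ : Measure Ω} {Φ : YoungFunction}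

theorem ext_ae {f g : OrliczSpace Φ μ}
    (h : ∀ᵐ x ∂μ, (f : Ω →ₘ[μ] ℂ) x = (g : Ω →ₘ[μ] ℂ) x) : f = g :=
  Subtype.ext (AEEqFun.ext h)

theorem coeFn_add (f g : OrliczSpace Φ μ) : ∀ᵐ x ∂μ,
    ((f + g : OrliczSpace Φ μ) : Ω →ₘ[μ] ℂ) x = (f : Ω →ₘ[μ] ℂ) x + (g : Ω →ₘ[μ] ℂ) x :=
  AEEqFun.coeFn_add (f : Ω →ₘ[μ] ℂ) (g : Ω →ₘ[μ] ℂ)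

theorem coeFn_sub (f g : OrliczSpace Φ μ) : ∀ᵐ x ∂μ,
    ((f - g : OrliczSpace Φ μ) : Ω →ₘ[μ] ℂ) x = (f : Ω →ₘ[μ] ℂ) x - (g : Ω →ₘ[μ] ℂ) x :=
  AEEqFun.coeFn_sub (f : Ω →ₘ[μ] ℂ) (g : Ω →ₘ[μ] ℂ)

theorem coeFn_smul (c : ℂ) (f : OrliczSpace Φ μ) : ∀ᵐ x ∂μ,
    ((c • f : OrliczSpace Φ μ) : Ω →ₘ[μ] ℂ) x = c * (f : Ω →ₘ[μ] ℂ) x :=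
  AEEqFun.coeFn_smul c (f : Ω →ₘ[μ] ℂ)

theorem coeFn_zero : ∀ᵐ x ∂μ, ((0 : OrliczSpace Φ μ) : Ω →ₘ[μ] ℂ) x = 0 :=
  AEEqFun.coeFn_zero (α := Ω) (β := ℂ) (μ := μ)

theorem orliczModular_le_of_norm_le {c : ℝ} (hc : 0 ≤ c) {f g : Ω →ₘ[μ] ℂ}
    (h : ∀ᵐ x ∂μ, ‖f x‖ ≤ ‖g x‖) : orliczModular Φ μ c f ≤ orliczModular Φ μ c g := by
  refine lintegral_mono_ae ?_
  filter_upwards [h] with x hx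
  exact ENNReal.ofReal_le_ofReal (Φ.mono (by positivity) (by gcongr))

/-- The lattice property of the norm, through which the operator estimates below reduce to pointwise
inequalities. -/
theorem norm_le_norm_of_ae_le {f g : OrliczSpace Φ μ}
    (h : ∀ᵐ x ∂μ, ‖(f : Ω →ₘ[μ] ℂ) x‖ ≤ ‖(g : Ω →ₘ[μ] ℂ) x‖) : ‖f‖ ≤ ‖g‖ := by
  refine le_of_forall_gt_imp_ge_of_dense fun k hk => ?_
  obtain ⟨hk0, hk1⟩ := modular_le_one hk
  exact norm_le hk0 ((orliczModular_le_of_norm_le (by positivity) h).trans hk1)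

theorem norm_le_mul_norm_of_ae_le {f g : OrliczSpace Φ μ} {C : ℝ} (hC : 0 ≤ C)
    (h : ∀ᵐ x ∂μ, ‖(f : Ω →ₘ[μ] ℂ) x‖ ≤ C * ‖(g : Ω →ₘ[μ] ℂ) x‖) : ‖f‖ ≤ C * ‖g‖ := by
  have h1 : ‖(C : ℂ) • g‖ = C * ‖g‖ := by
    rw [norm_smul, Complex.norm_real, Real.norm_of_nonneg hC]
  rw [← h1]
  refine norm_le_norm_of_ae_le ?_
  filter_upwards [h, coeFn_smul (C : ℂ) g] with x hx hs
  rwa [hs, norm_mul, Complex.norm_real, Real.norm_of_nonneg hC]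

theorem mul_norm_le_norm_of_ae_le {f g : OrliczSpace Φ μ} {C : ℝ} (hC : 0 ≤ C)
    (h : ∀ᵐ x ∂μ, C * ‖(f : Ω →ₘ[μ] ℂ) x‖ ≤ ‖(g : Ω →ₘ[μ] ℂ) x‖) : C * ‖f‖ ≤ ‖g‖ := by
  have h1 : ‖(C : ℂ) • f‖ = C * ‖f‖ := by
    rw [norm_smul, Complex.norm_real, Real.norm_of_nonneg hC]
  rw [← h1]
  refine norm_le_norm_of_ae_le ?_
  filter_upwards [h, coeFn_smul (C : ℂ) f] with x hx hs
  rwa [hs, norm_mul, Complex.norm_real, Real.norm_of_nonneg hC]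

/-- The product of `f` with the indicator function of a measurable set. -/
noncomputable def restrictFun {E : Set Ω} (hE : MeasurableSet E) (f : OrliczSpace Φ μ) :
    OrliczSpace Φ μ :=
  ⟨AEEqFun.mk (E.indicator (f : Ω →ₘ[μ] ℂ))
    ((f : Ω →ₘ[μ] ℂ).aestronglyMeasurable.indicator hE), by
    obtain ⟨k, hk, hf⟩ := f.2
    refine ⟨k, hk, (orliczModular_le_of_norm_le hk.le ?_).trans_lt hf⟩
    filter_upwards [AEEqFun.coeFn_mk (E.indicator (f : Ω →ₘ[μ] ℂ))
      ((f : Ω →ₘ[μ] ℂ).aestronglyMeasurable.indicator hE)] with x hx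
    rw [hx]
    exact norm_indicator_le_norm_self _ _⟩

theorem coeFn_restrictFun {E : Set Ω} (hE : MeasurableSet E) (f : OrliczSpace Φ μ) :
    ∀ᵐ x ∂μ, (restrictFun hE f : Ω →ₘ[μ] ℂ) x = E.indicator (f : Ω →ₘ[μ] ℂ) x :=
  AEEqFun.coeFn_mk (E.indicator (f : Ω →ₘ[μ] ℂ))
    ((f : Ω →ₘ[μ] ℂ).aestronglyMeasurable.indicator hE)

/-- Multiplication by the indicator function of a measurable set, as a bounded operator. -/
noncomputable def restrictOp {E : Set Ω} (hE : MeasurableSet E) :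
    OrliczSpace Φ μ →L[ℂ] OrliczSpace Φ μ :=
  LinearMap.mkContinuous
    { toFun := restrictFun hE
      map_add' := fun f g => ext_ae <| by
        filter_upwards [coeFn_restrictFun hE (f + g), coeFn_restrictFun hE f,
          coeFn_restrictFun hE g, coeFn_add f g,
          coeFn_add (restrictFun hE f) (restrictFun hE g)] with x h1 h2 h3 h4 h5
        rw [h1, h5, h2, h3]
        by_cases hx : x ∈ E
        · simp only [Set.indicator_of_mem hx, h4]
        · simp only [Set.indicator_of_notMem hx, add_zero]
      map_smul' := fun c f => ext_ae <| by
        filter_upwards [coeFn_restrictFun hE (c • f), coeFn_restrictFun hE f, coeFn_smul c f,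
          coeFn_smul c (restrictFun hE f)] with x h1 h2 h3 h4
        rw [RingHom.id_apply, h1, h4, h2]
        by_cases hx : x ∈ E
        · simp only [Set.indicator_of_mem hx, h3]
        · simp only [Set.indicator_of_notMem hx, mul_zero] } 1 fun f => by
    rw [one_mul]
    refine norm_le_norm_of_ae_le ?_
    filter_upwards [coeFn_restrictFun hE f] with x hx
    exact (congrArg norm hx).trans_le (norm_indicator_le_norm_self _ _)

theorem coeFn_restrictOp {E : Set Ω} (hE : MeasurableSet E) (f : OrliczSpace Φ μ) :
    ∀ᵐ x ∂μ, (restrictOp hE f : Ω →ₘ[μ] ℂ) x = E.indicator (f : Ω →ₘ[μ] ℂ) x :=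
  coeFn_restrictFun hE f

theorem restrictOp_restrictOp {E : Set Ω} (hE : MeasurableSet E) (f : OrliczSpace Φ μ) :
    restrictOp hE (restrictOp hE f) = restrictOp hE f := by
  refine ext_ae ?_
  filter_upwards [coeFn_restrictOp hE (restrictOp hE f), coeFn_restrictOp hE f] with x h1 h2
  rw [h1, h2]
  by_cases hx : x ∈ E <;> simp [hx, h2]

theorem coeFn_sum_restrictOp {E : ℕ → Set Ω} (hE : ∀ n, MeasurableSet (E n))
    (hd : Pairwise fun i j => Disjoint (E i) (E j)) (s : Finset ℕ) (f : OrliczSpace Φ μ) :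
    ∀ᵐ x ∂μ, ((∑ n ∈ s, restrictOp (hE n) f : OrliczSpace Φ μ) : Ω →ₘ[μ] ℂ) x
      = (⋃ n ∈ s, E n).indicator (f : Ω →ₘ[μ] ℂ) x := by
  induction s using Finset.induction_on with
  | empty =>
    filter_upwards [coeFn_zero (Φ := Φ) (μ := μ)] with x hx
    simpa using hx
  | insert a s ha ih =>
    rw [Finset.sum_insert ha, Finset.set_biUnion_insert]
    filter_upwards [ih, coeFn_add (restrictOp (hE a) f) (∑ n ∈ s, restrictOp (hE n) f),
      coeFn_restrictOp (hE a) f] with x h1 h2 h3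
    rw [h2, h1, h3, Set.indicator_union_of_disjoint]
    exact Set.disjoint_iUnion₂_right.2 fun n hn => hd fun h => ha (h ▸ hn)

/-- By disjointness the sum is multiplication by one indicator function. -/
theorem norm_sum_restrictOp_le {E : ℕ → Set Ω} (hE : ∀ n, MeasurableSet (E n))
    (hd : Pairwise fun i j => Disjoint (E i) (E j)) (s : Finset ℕ) (f : OrliczSpace Φ μ) :
    ‖∑ n ∈ s, restrictOp (hE n) f‖ ≤ ‖f‖ := by
  refine norm_le_norm_of_ae_le ?_
  filter_upwards [coeFn_sum_restrictOp hE hd s f] with x hx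
  rw [hx]
  exact norm_indicator_le_norm_self _ _

theorem exists_restrictOp_ne_zero [SigmaFinite μ] {E : Set Ω} (hE : MeasurableSet E)
    (hpos : 0 < μ E) : ∃ f : OrliczSpace Φ μ, restrictOp hE f ≠ 0 := by
  -- The indicator of `E` need not lie in the space when `μ E = ∞`; that of `t` does.
  obtain ⟨t, htm, hts, ht0, ht1⟩ := Measure.exists_subset_measure_lt_top hE hpos
  have hmeas : AEStronglyMeasurable (t.indicator fun _ => (1 : ℂ)) μ :=
    aestronglyMeasurable_const.indicator htm
  have hmk := AEEqFun.coeFn_mk (μ := μ) (t.indicator fun _ => (1 : ℂ)) hmeas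
  let f : OrliczSpace Φ μ := ⟨AEEqFun.mk (t.indicator fun _ => (1 : ℂ)) hmeas, by
    refine ⟨1, one_pos, ?_⟩
    have h : orliczModular Φ μ 1 (AEEqFun.mk (t.indicator fun _ => (1 : ℂ)) hmeas)
        = ∫⁻ x, t.indicator (fun _ => ENNReal.ofReal (Φ 1)) x ∂μ := by
      refine lintegral_congr_ae ?_
      filter_upwards [hmk] with x hx
      rw [hx]
      by_cases hxt : x ∈ t <;> simp [hxt, Φ.map_zero]
    rw [h, lintegral_indicator_const htm]
    exact ENNReal.mul_lt_top ENNReal.ofReal_lt_top ht1⟩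
  refine ⟨f, fun h0 => ht0.ne' ?_⟩
  have h1 := coeFn_restrictOp hE f
  rw [h0] at h1
  have h2 : ∀ᵐ x ∂μ, x ∉ t := by
    filter_upwards [h1, hmk, coeFn_zero (Φ := Φ) (μ := μ)] with x h1 h2 h3 hxt
    have h4 : (f : Ω →ₘ[μ] ℂ) x = 1 := h2.trans (by simp [hxt])
    rw [h3, Set.indicator_of_mem (hts hxt), h4] at h1
    exact zero_ne_one h1
  simpa [ae_iff] using h2

/-- All functions are a.e. constant on `A`, so their restrictions are multiples of one nonzero
restriction `g`. -/
theorem finiteDimensional_range_restrictOp_of_atom [SigmaFinite μ] {A : Set Ω}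
    (hA : IsMeasureAtom μ A) (hAm : MeasurableSet A) :
    FiniteDimensional ℂ (restrictOp (Φ := Φ) (μ := μ) hAm).range := by
  obtain ⟨g, hg⟩ := exists_restrictOp_ne_zero (Φ := Φ) hAm hA.2.1
  obtain ⟨c, hc⟩ := hA.exists_ae_eq_const (f := (g : Ω →ₘ[μ] ℂ)) (AEEqFun.measurable _)
  have hc0 : c ≠ 0 := by
    rintro rfl
    refine hg (ext_ae ?_)
    filter_upwards [hc, coeFn_restrictOp hAm g, coeFn_zero (Φ := Φ) (μ := μ)] with x h1 h2 h3
    rw [h2, h3]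
    by_cases hx : x ∈ A <;> simp [hx, h1]
  refine Submodule.finiteDimensional_of_le (S₂ := Submodule.span ℂ {restrictOp hAm g}) ?_
  rintro _ ⟨f, rfl⟩
  obtain ⟨d, hd⟩ := hA.exists_ae_eq_const (f := (f : Ω →ₘ[μ] ℂ)) (AEEqFun.measurable _)
  refine Submodule.mem_span_singleton.2 ⟨d / c, ext_ae ?_⟩
  filter_upwards [hc, hd, coeFn_restrictOp hAm g, coeFn_restrictOp hAm f,
    coeFn_smul (d / c) (restrictOp hAm g)] with x h1 h2 h3 h4 h5
  refine h5.trans (Eq.trans ?_ h4.symm)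
  rw [h3]
  by_cases hx : x ∈ A
  · simp [hx, h1 hx, h2 hx, hc0]
  · simp [hx]

theorem finiteDimensional_range_restrictOp_union {E F : Set Ω} (hE : MeasurableSet E)
    (hF : MeasurableSet F) (hEF : MeasurableSet (E ∪ F))
    (hEfd : FiniteDimensional ℂ (restrictOp (Φ := Φ) (μ := μ) hE).range)
    (hFfd : FiniteDimensional ℂ (restrictOp (Φ := Φ) (μ := μ) hF).range) :
    FiniteDimensional ℂ (restrictOp (Φ := Φ) (μ := μ) hEF).range := by
  refine Submodule.finiteDimensional_of_le (S₂ := (restrictOp (Φ := Φ) (μ := μ) hE).range ⊔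
    (restrictOp (Φ := Φ) (μ := μ) hF).range) ?_
  rintro _ ⟨f, rfl⟩
  -- Removing the part on `E` before restricting to `F` avoids counting `E ∩ F` twice; the atoms are
  -- not assumed disjoint.
  refine Submodule.mem_sup.2 ⟨_, ⟨f, rfl⟩, _, ⟨f - restrictOp hE f, rfl⟩, ext_ae ?_⟩
  filter_upwards [coeFn_add (restrictOp hE f) (restrictOp hF (f - restrictOp hE f)),
    coeFn_restrictOp hE f, coeFn_restrictOp hF (f - restrictOp hE f), coeFn_restrictOp hEF f,
    coeFn_sub f (restrictOp hE f)] with x h1 h2 h3 h4 h5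
  refine h1.trans (Eq.trans ?_ h4.symm)
  rw [h2, h3]
  have h6 : F.indicator (((f - restrictOp hE f : OrliczSpace Φ μ) : Ω →ₘ[μ] ℂ) : Ω → ℂ) x
      = F.indicator (fun _ => (f : Ω →ₘ[μ] ℂ) x - E.indicator (f : Ω →ₘ[μ] ℂ) x) x := by
    by_cases hx : x ∈ F
    · rw [Set.indicator_of_mem hx, Set.indicator_of_mem hx, h5, h2]
    · rw [Set.indicator_of_notMem hx, Set.indicator_of_notMem hx]
  rw [h6]
  by_cases hx : x ∈ E <;> by_cases hx' : x ∈ F <;> simp [hx, hx']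

theorem finiteDimensional_range_restrictOp [SigmaFinite μ] {N : Set Ω} (hN : MeasurableSet N)
    (h : ConsistsOfFinitelyManyAtoms μ N) :
    FiniteDimensional ℂ (restrictOp (Φ := Φ) (μ := μ) hN).range := by
  obtain ⟨S, hS, hSa, hNS⟩ := h
  have key : ∃ hm : MeasurableSet (⋃₀ S),
      FiniteDimensional ℂ (restrictOp (Φ := Φ) (μ := μ) hm).range := by
    clear hNS
    induction S, hS using Set.Finite.induction_on with
    | empty =>
      refine ⟨by simp, Submodule.finiteDimensional_of_le (S₂ := ⊥) ?_⟩
      rintro _ ⟨f, rfl⟩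
      refine (Submodule.mem_bot ℂ).2 (ext_ae ?_)
      filter_upwards [coeFn_restrictOp (E := ⋃₀ (∅ : Set (Set Ω))) (by simp) f,
        coeFn_zero (Φ := Φ) (μ := μ)] with x h1 h2
      refine h1.trans (Eq.trans ?_ h2.symm)
      simp
    | @insert A S _ _ ih =>
      obtain ⟨hm, hfd⟩ := ih fun B hB => hSa B (Set.mem_insert_of_mem _ hB)
      have hA := hSa A (Set.mem_insert _ _)
      have hfdA := finiteDimensional_range_restrictOp_of_atom (Φ := Φ) hA hA.1
      rw [Set.sUnion_insert]
      exact ⟨hA.1.union hm, finiteDimensional_range_restrictOp_union hA.1 hm _ hfdA hfd⟩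
  obtain ⟨hm, hfd⟩ := key
  have heq : restrictOp (Φ := Φ) (μ := μ) hN = restrictOp hm := by
    refine ContinuousLinearMap.ext fun f => ext_ae ?_
    filter_upwards [coeFn_restrictOp hN f, coeFn_restrictOp hm f, hNS.mem_iff] with x h1 h2 h3
    rw [h1, h2]
    by_cases hx : x ∈ N
    · simp only [Set.indicator_of_mem hx, Set.indicator_of_mem (h3.1 hx)]
    · simp only [Set.indicator_of_notMem hx, Set.indicator_of_notMem (fun h => hx (h3.2 h))]
  rw [heq]
  exact hfd

/-! ### The two bounds for the multiplication operator -/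

section Multiplication

variable [SigmaFinite μ] {u : Ω → ℂ} {M : OrliczSpace Φ μ →L[ℂ] OrliczSpace Φ μ}

/-- The symbol of a bounded multiplication operator is essentially bounded by the norm. -/
theorem measure_norm_symbol_ge_eq_zero (hu : Measurable u)
    (hM : ∀ f : OrliczSpace Φ μ, (M f : Ω →ₘ[μ] ℂ) =ᵐ[μ] fun x => u x * (f : Ω →ₘ[μ] ℂ) x)
    {ε : ℝ} (hε : ‖M‖ < ε) : μ {x | ε ≤ ‖u x‖} = 0 := by
  by_contra hne
  have hN : MeasurableSet {x | ε ≤ ‖u x‖} := measurableSet_le measurable_const hu.norm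
  obtain ⟨f, hf⟩ := exists_restrictOp_ne_zero (Φ := Φ) hN (pos_iff_ne_zero.2 hne)
  set g := restrictOp hN f
  have h1 : ε * ‖g‖ ≤ ‖M g‖ := by
    refine mul_norm_le_norm_of_ae_le ((norm_nonneg M).trans hε.le) ?_
    filter_upwards [hM g, coeFn_restrictOp hN f] with x h1 h2
    rw [h1, norm_mul]
    by_cases hx : ε ≤ ‖u x‖
    · gcongr
    · have h0 : (g : Ω →ₘ[μ] ℂ) x = 0 := h2.trans (by simp [hx])
      simp [h0]
  have h2 := M.le_opNorm g
  have h3 : 0 < ‖g‖ := norm_pos_iff.2 hf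
  nlinarith

/-- The compact approximant is `M` followed by restriction to `{ε ≤ |u|}`; the difference multiplies
by `u` only where `|u| < ε`. -/
theorem essNorm_le_of_consistsOfFinitelyManyAtoms (hu : Measurable u)
    (hM : ∀ f : OrliczSpace Φ μ, (M f : Ω →ₘ[μ] ℂ) =ᵐ[μ] fun x => u x * (f : Ω →ₘ[μ] ℂ) x)
    {ε : ℝ} (hε : 0 < ε) (h : ConsistsOfFinitelyManyAtoms μ {x | ε ≤ ‖u x‖}) :
    essNorm M ≤ ε := by
  have hN : MeasurableSet {x | ε ≤ ‖u x‖} := measurableSet_le measurable_const hu.norm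
  have hfd := finiteDimensional_range_restrictOp (Φ := Φ) hN h
  have hK : IsCompactOperator ((restrictOp hN).comp M) :=
    isCompactOperator_of_mem_finiteDimensional _ (restrictOp (Φ := Φ) (μ := μ) hN).range
      fun f => ⟨M f, rfl⟩
  refine (essNorm_le M hK).trans (ContinuousLinearMap.opNorm_le_bound _ hε.le fun f => ?_)
  refine norm_le_mul_norm_of_ae_le hε.le ?_
  filter_upwards [hM f, coeFn_restrictOp hN (M f), coeFn_sub (M f) (restrictOp hN (M f))]
    with x h1 h2 h3
  refine (congrArg norm h3).trans_le ?_
  rw [h2]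
  by_cases hx : ε ≤ ‖u x‖
  · rw [Set.indicator_of_mem (by simpa using hx), sub_self, norm_zero]
    positivity
  · rw [Set.indicator_of_notMem (by simpa using hx), sub_zero, h1, norm_mul]
    have := (not_le.1 hx).le
    gcongr

theorem essNorm_le_atomicThreshold (hu : Measurable u)
    (hM : ∀ f : OrliczSpace Φ μ, (M f : Ω →ₘ[μ] ℂ) =ᵐ[μ] fun x => u x * (f : Ω →ₘ[μ] ℂ) x) :
    essNorm M ≤ atomicThreshold μ u := by
  -- The infimum is over a nonempty set because `|u| < ‖M‖ + 1` a.e., so that level set is a union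
  -- of zero atoms.
  refine le_csInf ⟨‖M‖ + 1, by positivity, consistsOfFinitelyManyAtoms_of_null
    (measure_norm_symbol_ge_eq_zero hu hM (lt_add_one _))⟩ ?_
  rintro ε ⟨hε, h⟩
  exact essNorm_le_of_consistsOfFinitelyManyAtoms hu hM hε h

/-- The lower bound for the essential norm holds in every Orlicz space: neither `Δ₂` nor a
restriction on the measures of the atoms is needed. -/
theorem atomicThreshold_le_essNorm (hu : Measurable u)
    (hM : ∀ f : OrliczSpace Φ μ, (M f : Ω →ₘ[μ] ℂ) =ᵐ[μ] fun x => u x * (f : Ω →ₘ[μ] ℂ) x) :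
    atomicThreshold μ u ≤ essNorm M := by
  refine le_essNorm fun S hS => le_of_forall_lt_imp_le_of_dense fun ε hε => ?_
  rcases le_or_gt ε 0 with hε0 | hε0
  · exact hε0.trans (norm_nonneg _)
  have hnot : ¬ ConsistsOfFinitelyManyAtoms μ {x | ε ≤ ‖u x‖} := fun h =>
    hε.not_ge (csInf_le ⟨0, fun _ hr => hr.1.le⟩ ⟨hε0, h⟩)
  obtain ⟨E, hEm, hEN, hEp, hEd⟩ := exists_disjoint_seq_of_not_finitelyManyAtoms
    (measurableSet_le measurable_const hu.norm) hnot
  have hlow : ∀ n (f : OrliczSpace Φ μ), ε * ‖restrictOp (hEm n) f‖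
      ≤ ‖restrictOp (hEm n) (M (restrictOp (hEm n) f))‖ := by
    intro n f
    refine mul_norm_le_norm_of_ae_le hε0.le ?_
    filter_upwards [coeFn_restrictOp (hEm n) f, hM (restrictOp (hEm n) f),
      coeFn_restrictOp (hEm n) (M (restrictOp (hEm n) f))] with x h1 h2 h3
    rw [h3, h1]
    by_cases hx : x ∈ E n
    · rw [Set.indicator_of_mem hx, Set.indicator_of_mem hx, h2, h1, Set.indicator_of_mem hx,
        norm_mul]
      have : ε ≤ ‖u x‖ := hEN n hx
      gcongr
    · simp [hx]
  exact le_norm_sub_of_isCompactOperator hS (Q := fun n => restrictOp (hEm n))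
    (fun s f => norm_sum_restrictOp_le hEm hEd s f)
    (fun n f => restrictOp_restrictOp (hEm n) f)
    (fun n => exists_restrictOp_ne_zero (hEm n) (hEp n)) hlow

end Multiplication

end OrliczSpace

theorem corollary3p4 {Ω : Type*} [MeasurableSpace Ω] (μ : Measure Ω) [SigmaFinite μ]
    (Φ : YoungFunction) (u : Ω → ℂ) (hu : Measurable u)
    (M : OrliczSpace Φ μ →L[ℂ] OrliczSpace Φ μ)
    (hM : ∀ f : OrliczSpace Φ μ, (M f : Ω →ₘ[μ] ℂ) =ᵐ[μ] fun x => u x * (f : Ω →ₘ[μ] ℂ) x) :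
    essNorm M ≤ atomicThreshold μ u ∧
      (Φ.DeltaTwo →
        ∀ {ι : Type*} (A : ι → Set Ω), IsAtomDecomposition μ A →
          (Tendsto (fun i => (μ (A i)).toReal) cofinite (𝓝 0) ∨
            NoConvergentSubsequence (fun i => (μ (A i)).toReal)) →
          essNorm M = atomicThreshold μ u) :=
  ⟨OrliczSpace.essNorm_le_atomicThreshold hu hM, fun _ _ _ _ _ =>
    le_antisymm (OrliczSpace.essNorm_le_atomicThreshold hu hM)
      (OrliczSpace.atomicThreshold_le_essNorm hu hM)⟩
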